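/- Let $\mathcal L$ be the propositional language with variables $p_0,p_1,\dots$, the Boolean connectives $\neg,\wedge$ (and those defined from them), and two unary modal operators $\Box$ and $\forall$, with $\exists=\neg\forall\neg$. A normal modal logic with the universal modality is a set of $\mathcal L$-formulas that contains all propositional tautologies and the axioms $\Box(p\to q)\to(\Box p\to\Box q)$, $\forall(p\to q)\to(\forall p\to\forall q)$, $\forall p\to p$, $\forall p\to\forall\forall p$, $p\to\forall\exists p$ and $\forall p\to\Box p$, and is closed under modus ponens, the necessitation rules $\varphi/\Box\varphi$ and $\varphi/\forall\varphi$, and uniform substitution. Let $\mathsf{K}_u$ be the smallest such logic, and $\mathsf{K4}_u$ the smallest such logic that contains $\Box p\to\Box\Box p$. Theorem. For every normal modal logic $L$ with the universal modality such that $\mathsf K_u\subseteq L\subseteq\mathsf{K4}_u$, the unification problem for $L$ is undecidable: no algorithm decides, given an $\mathcal L$-formula $\varphi$, whether there is a substitution $\sigma$ of $\mathcal L$-formulas for the propositional variables such that $\sigma(\varphi)\in L$. -/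

import Mathlib

/-- Formulas of the propositional language with variables `p₀, p₁, …`, primitive Boolean
connectives `¬`, `∧`, and two unary modal operators: `box` (written `□`) and the universal
modality `univ` (written `∀`). -/
inductive UForm : Type where
  | var : ℕ → UForm
  | neg : UForm → UForm
  | and : UForm → UForm → UForm
  | box : UForm → UForm
  | univ : UForm → UForm

namespace UForm

/-- `φ → ψ`, as `¬(φ ∧ ¬ψ)`. -/
def imp (φ ψ : UForm) : UForm := neg (and φ (neg ψ))

/-- `∃φ`, the dual `¬∀¬φ` of the universal modality. -/
def exist (φ : UForm) : UForm := neg (univ (neg φ))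

/-- Application of the substitution `σ` (a map from variables to formulas) to a formula. -/
def subst (σ : ℕ → UForm) : UForm → UForm
  | var n => σ n
  | neg φ => neg (subst σ φ)
  | and φ ψ => and (subst σ φ) (subst σ ψ)
  | box φ => box (subst σ φ)
  | univ φ => univ (subst σ φ)

/-- `φ` is a propositional tautology: it is true under every truth assignment to all formulas
that respects `¬` and `∧` (variables and formulas `□ψ`, `∀ψ` are treated as atoms). -/
def IsTautology (φ : UForm) : Prop :=
  ∀ e : UForm → Prop, (∀ ψ, e (neg ψ) ↔ ¬ e ψ) → (∀ ψ χ, e (and ψ χ) ↔ (e ψ ∧ e χ)) → e φ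

/-- A Gödel numbering of formulas. -/
def toNat : UForm → ℕ
  | var n => 5 * n
  | neg φ => 5 * toNat φ + 1
  | box φ => 5 * toNat φ + 2
  | univ φ => 5 * toNat φ + 3
  | and φ ψ => 5 * Nat.pair (toNat φ) (toNat ψ) + 4

theorem toNat_injective : Function.Injective toNat := by
  intro φ
  induction φ with
  | var n => intro ψ h; cases ψ <;> simp only [toNat] at h <;> first | omega | (congr 1; omega)
  | neg φ ih =>
    intro ψ h
    cases ψ <;> simp only [toNat] at h <;> first | omega | (congr 1; apply ih; omega)
  | box φ ih =>
    intro ψ h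
    cases ψ <;> simp only [toNat] at h <;> first | omega | (congr 1; apply ih; omega)
  | univ φ ih =>
    intro ψ h
    cases ψ <;> simp only [toNat] at h <;> first | omega | (congr 1; apply ih; omega)
  | and φ₁ φ₂ ih₁ ih₂ =>
    intro ψ h
    cases ψ with
    | and ψ₁ ψ₂ =>
      simp only [toNat] at h
      have h' : Nat.pair (toNat φ₁) (toNat φ₂) = Nat.pair (toNat ψ₁) (toNat ψ₂) := by omega
      obtain ⟨h₁, h₂⟩ := Nat.pair_eq_pair.1 h'
      rw [ih₁ h₁, ih₂ h₂]
    | _ => simp only [toNat] at h; omega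

theorem toNat_surjective : Function.Surjective toNat := by
  intro n
  induction n using Nat.strong_induction_on with
  | _ n ih =>
    have hn : n = 5 * (n / 5) + n % 5 := (Nat.div_add_mod n 5).symm
    have hlt : n % 5 < 5 := Nat.mod_lt _ (by norm_num)
    generalize hr : n % 5 = r at hn hlt
    generalize n / 5 = m at hn
    have hm : r ≠ 0 → m < n := by omega
    rcases Nat.lt_or_ge r 4 with h4 | h4
    · rcases Nat.eq_zero_or_pos r with h0 | h0
      · exact ⟨var m, by simp only [toNat]; omega⟩
      · obtain ⟨φ, hφ⟩ := ih m (hm (by omega))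
        have h123 : r = 1 ∨ r = 2 ∨ r = 3 := by omega
        rcases h123 with h | h | h
        · exact ⟨neg φ, by simp only [toNat]; omega⟩
        · exact ⟨box φ, by simp only [toNat]; omega⟩
        · exact ⟨univ φ, by simp only [toNat]; omega⟩
    · have hlt' := hm (by omega)
      obtain ⟨φ, hφ⟩ := ih m.unpair.1 (lt_of_le_of_lt (Nat.unpair_left_le m) hlt')
      obtain ⟨ψ, hψ⟩ := ih m.unpair.2 (lt_of_le_of_lt (Nat.unpair_right_le m) hlt')
      refine ⟨and φ ψ, ?_⟩
      simp only [toNat, hφ, hψ, Nat.pair_unpair]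
      omega

/-- The Gödel numbering as a bijection with `ℕ`. -/
noncomputable def equivNat : UForm ≃ ℕ :=
  Equiv.ofBijective toNat ⟨toNat_injective, toNat_surjective⟩

/-- Algorithms on formulas operate on their Gödel numbers. -/
noncomputable instance instPrimcodable : Primcodable UForm := Primcodable.ofEquiv ℕ equivNat

end UForm

open UForm in
/-- Normal modal logics with the universal modality: sets of formulas that contain all
propositional tautologies and the axioms below (with `p = p₀`, `q = p₁`), closed under modus
ponens, both necessitation rules and uniform substitution. -/
structure IsNormalLogicU (L : Set UForm) : Prop where
  taut : ∀ φ, IsTautology φ → φ ∈ L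
  box_K : imp (box (imp (var 0) (var 1))) (imp (box (var 0)) (box (var 1))) ∈ L
  univ_K : imp (univ (imp (var 0) (var 1))) (imp (univ (var 0)) (univ (var 1))) ∈ L
  univ_T : imp (univ (var 0)) (var 0) ∈ L
  univ_4 : imp (univ (var 0)) (univ (univ (var 0))) ∈ L
  univ_B : imp (var 0) (univ (exist (var 0))) ∈ L
  univ_box : imp (univ (var 0)) (box (var 0)) ∈ L
  mp : ∀ φ ψ, imp φ ψ ∈ L → φ ∈ L → ψ ∈ L
  nec_box : ∀ φ, φ ∈ L → box φ ∈ L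
  nec_univ : ∀ φ, φ ∈ L → univ φ ∈ L
  subst_mem : ∀ (σ : ℕ → UForm) (φ : UForm), φ ∈ L → subst σ φ ∈ L

/-- `K_u`, the smallest normal modal logic with the universal modality. -/
def logicKu : Set UForm := ⋂₀ {L | IsNormalLogicU L}

open UForm in
/-- `K4_u`, the smallest normal modal logic with the universal modality that contains
`□p → □□p`. -/
def logicK4u : Set UForm :=
  ⋂₀ {L | IsNormalLogicU L ∧ imp (box (var 0)) (box (box (var 0))) ∈ L}

/-- The formula `φ` is unifiable in `L`: some substitution instance of it belongs to `L`. -/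
def UnifiableIn (L : Set UForm) (φ : UForm) : Prop := ∃ σ : ℕ → UForm, UForm.subst σ φ ∈ L

/-! The halting problem is reduced to unifiability. Every partial recursive function is definable by
a Horn program of valid clauses over zero and successor (`definable_of_partrec`). A program becomes
a modal formula `η` in which the clause variables are the propositional variables from `p₁` on, a
numeral `n` is a closed formula whose least point on a chain is the `n`-th, and a fact is a closed
formula beginning with `∃`. The formula `η → fact` is then unifiable exactly when the fact is true.

From derivations to unifiers: one application of a clause amounts to one substitution of numerals.
Facts are global, that is, constant across the universal modality, so two substitutions can be
merged by a case distinction on such a formula (`Enforces.step`). Induction on the derivation thus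
yields a single substitution for the whole derivation, in any normal `L`.

From unifiers to truth: as `L ⊆ K4_u`, a unified formula is valid in every transitive frame. In the
frame built from the intended facts, `η` holds under every valuation, because each variable acts as
the least number of its chain points (`FactFrame.sat_ofProgram`). Whatever the unifier is, the fact
must therefore hold in the frame, which means that it is true. -/

/-! ### Horn programs over the natural numbers -/

namespace Horn

/-- Terms built from zero, successor and six variables. -/
inductive Tm : Type where
  | zero : Tm
  | var : Fin 6 → Tm
  | succ : Tm → Tm

namespace Tm

/-- The value of a term under an assignment. -/
def eval (ρ : Fin 6 → ℕ) : Tm → ℕ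
  | zero => 0
  | var v => ρ v
  | succ t => eval ρ t + 1

/-- The numeral of a natural number. -/
def ofNat : ℕ → Tm
  | 0 => zero
  | n + 1 => succ (ofNat n)

theorem eval_ofNat (ρ : Fin 6 → ℕ) (n : ℕ) : (ofNat n).eval ρ = n := by
  induction n with
  | zero => rfl
  | succ n ih => simp [ofNat, eval, ih]

end Tm

/-- An atomic formula; the predicate symbol is its intended interpretation. -/
structure Atom where
  rel : ℕ → ℕ → ℕ → Prop
  fst : Tm
  snd : Tm
  trd : Tm

/-- Truth of an atom under an assignment. -/
def Atom.Holds (ρ : Fin 6 → ℕ) (A : Atom) : Prop :=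
  A.rel (A.fst.eval ρ) (A.snd.eval ρ) (A.trd.eval ρ)

/-- A Horn clause. -/
structure Clause where
  prems : List Atom
  concl : Atom

/-- A clause is valid when it is true under every assignment. -/
def Clause.Valid (C : Clause) : Prop :=
  ∀ ρ, (∀ A ∈ C.prems, A.Holds ρ) → C.concl.Holds ρ

/-- Derivability of facts from a Horn program. -/
inductive Derives (P : List Clause) : (ℕ → ℕ → ℕ → Prop) → ℕ → ℕ → ℕ → Prop where
  | rule (C : Clause) (hC : C ∈ P) (ρ : Fin 6 → ℕ)
      (h : ∀ A ∈ C.prems, Derives P A.rel (A.fst.eval ρ) (A.snd.eval ρ) (A.trd.eval ρ)) :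
      Derives P C.concl.rel (C.concl.fst.eval ρ) (C.concl.snd.eval ρ) (C.concl.trd.eval ρ)

theorem Derives.mono {P Q : List Clause} (h : P ⊆ Q) {r : ℕ → ℕ → ℕ → Prop} {x y z : ℕ}
    (hd : Derives P r x y z) : Derives Q r x y z := by
  induction hd with
  | rule C hC ρ _ ih => exact .rule C (h hC) ρ ih

open Tm

/-- The graph of addition. -/
def addRel (x y z : ℕ) : Prop := x + y = z

/-- The graph of multiplication. -/
def mulRel (x y z : ℕ) : Prop := x * y = z

/-- The graph of the pairing function. -/
def pairRel (x y z : ℕ) : Prop := Nat.pair x y = z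

/-- A Horn program for the pairing function. -/
def pairProgram : List Clause :=
  [⟨[], ⟨addRel, zero, var 0, var 0⟩⟩,
   ⟨[⟨addRel, var 0, var 1, var 2⟩], ⟨addRel, succ (var 0), var 1, succ (var 2)⟩⟩,
   ⟨[], ⟨mulRel, zero, var 0, zero⟩⟩,
   ⟨[⟨mulRel, var 0, var 1, var 2⟩, ⟨addRel, var 2, var 1, var 3⟩],
     ⟨mulRel, succ (var 0), var 1, var 3⟩⟩,
   ⟨[⟨addRel, var 0, succ (var 2), var 1⟩, ⟨mulRel, var 1, var 1, var 3⟩,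
      ⟨addRel, var 3, var 0, var 4⟩], ⟨pairRel, var 0, var 1, var 4⟩⟩,
   ⟨[⟨addRel, var 1, var 2, var 0⟩, ⟨mulRel, var 0, var 0, var 3⟩,
      ⟨addRel, var 3, var 0, var 4⟩, ⟨addRel, var 4, var 1, var 5⟩],
      ⟨pairRel, var 0, var 1, var 5⟩⟩]

/-- The two branches of `Nat.pair` are separated by addition alone: `x + (k + 1) = y` expresses `x <
y`, and `y + k = x` expresses `y ≤ x`. -/
theorem pairProgram_valid : ∀ C ∈ pairProgram, C.Valid := by
  simp only [pairProgram, List.forall_mem_cons, List.not_mem_nil, Clause.Valid, Atom.Holds,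
    Tm.eval, addRel, mulRel, pairRel, false_imp_iff, implies_true, and_true,
    true_imp_iff]
  refine ⟨?_, ?_, ?_, ?_, ?_, ?_⟩ <;> intro ρ
  · simp
  · intro h; omega
  · simp
  · rintro ⟨h₁, h₂⟩; rw [Nat.succ_mul, h₁, h₂]
  · rintro ⟨h₁, h₂, h₃⟩
    rw [Nat.pair, if_pos (by omega), h₂, h₃]
  · rintro ⟨h₁, h₂, h₃, h₄⟩
    rw [Nat.pair, if_neg (by omega), h₂, h₃, h₄]

theorem derives_add (x y : ℕ) : Derives pairProgram addRel x y (x + y) := by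
  induction x with
  | zero =>
    rw [Nat.zero_add]
    exact .rule ⟨[], ⟨addRel, zero, var 0, var 0⟩⟩ (by simp [pairProgram]) ![y, 0, 0, 0, 0, 0]
      (by simp)
  | succ x ih =>
    rw [Nat.succ_add]
    exact .rule ⟨[⟨addRel, var 0, var 1, var 2⟩], ⟨addRel, succ (var 0), var 1, succ (var 2)⟩⟩
      (by simp [pairProgram]) ![x, y, x + y, 0, 0, 0] (by simpa [Tm.eval] using ih)

theorem derives_mul (x y : ℕ) : Derives pairProgram mulRel x y (x * y) := by
  induction x with
  | zero =>
    rw [Nat.zero_mul]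
    exact .rule ⟨[], ⟨mulRel, zero, var 0, zero⟩⟩ (by simp [pairProgram]) ![y, 0, 0, 0, 0, 0]
      (by simp)
  | succ x ih =>
    rw [Nat.succ_mul]
    exact .rule ⟨[⟨mulRel, var 0, var 1, var 2⟩, ⟨addRel, var 2, var 1, var 3⟩],
      ⟨mulRel, succ (var 0), var 1, var 3⟩⟩
      (by simp [pairProgram]) ![x, y, x * y, x * y + y, 0, 0]
      (by simpa [Tm.eval] using ⟨ih, derives_add _ _⟩)

theorem derives_pair (x y : ℕ) : Derives pairProgram pairRel x y (Nat.pair x y) := by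
  rw [Nat.pair]
  split_ifs with h
  · obtain ⟨k, rfl⟩ := Nat.exists_eq_add_of_lt h
    exact .rule ⟨[⟨addRel, var 0, succ (var 2), var 1⟩, ⟨mulRel, var 1, var 1, var 3⟩,
      ⟨addRel, var 3, var 0, var 4⟩], ⟨pairRel, var 0, var 1, var 4⟩⟩ (by simp [pairProgram])
      ![x, x + k + 1, k, _, _, 0]
      (by simpa [Tm.eval] using ⟨derives_add x (k + 1), derives_mul _ _, derives_add _ _⟩)
  · obtain ⟨k, rfl⟩ := Nat.exists_eq_add_of_le (not_lt.1 h)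
    exact .rule ⟨[⟨addRel, var 1, var 2, var 0⟩, ⟨mulRel, var 0, var 0, var 3⟩,
      ⟨addRel, var 3, var 0, var 4⟩, ⟨addRel, var 4, var 1, var 5⟩],
      ⟨pairRel, var 0, var 1, var 5⟩⟩ (by simp [pairProgram])
      ![y + k, y, k, _, _, _]
      (by simpa [Tm.eval] using
        ⟨derives_add y k, derives_mul _ _, derives_add _ _, derives_add _ _⟩)

/-- The graph of a partial function, with a dummy third argument. -/
def graph (f : ℕ →. ℕ) (x y _z : ℕ) : Prop := y ∈ f x

/-- A partial function is Horn definable if all facts about its graph are derivable from a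
program of valid clauses. -/
def Definable (f : ℕ →. ℕ) : Prop :=
  ∃ P : List Clause, (∀ C ∈ P, C.Valid) ∧ ∀ x, ∀ y ∈ f x, Derives P (graph f) x y 0

theorem forall_mem_append₃ {P Q S : List Clause} (hP : ∀ C ∈ P, C.Valid)
    (hQ : ∀ C ∈ Q, C.Valid) (hS : ∀ C ∈ S, C.Valid) : ∀ C ∈ P ++ Q ++ S, C.Valid := by
  intro C hC
  rcases List.mem_append.1 hC with hC | hC
  · rcases List.mem_append.1 hC with hC | hC
    exacts [hP C hC, hQ C hC]
  · exact hS C hC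

/-- Definability from the pairing function and two definable functions by further clauses. -/
theorem Definable.of_clauses {f g h : ℕ →. ℕ} (hf : Definable f) (hg : Definable g)
    (S : List Clause) (hS : ∀ C ∈ S, C.Valid)
    (H : ∀ Q : List Clause, S ⊆ Q → (∀ x y, Derives Q pairRel x y (Nat.pair x y)) →
      (∀ x, ∀ y ∈ f x, Derives Q (graph f) x y 0) →
      (∀ x, ∀ y ∈ g x, Derives Q (graph g) x y 0) →
      ∀ x, ∀ y ∈ h x, Derives Q (graph h) x y 0) : Definable h := by
  obtain ⟨P, hP, hPf⟩ := hf
  obtain ⟨P', hP', hPg⟩ := hg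
  refine ⟨P ++ P' ++ (pairProgram ++ S), forall_mem_append₃ hP hP' ?_, H _ ?_ ?_ ?_ ?_⟩
  · intro C hC
    rcases List.mem_append.1 hC with hC | hC
    exacts [pairProgram_valid C hC, hS C hC]
  · intro C; simp +contextual
  · exact fun x y => (derives_pair x y).mono fun C => by simp +contextual
  · exact fun x y hy => (hPf x y hy).mono fun C => by simp +contextual
  · exact fun x y hy => (hPg x y hy).mono fun C => by simp +contextual

/-! ### Closure of Horn definability under the schemes for partial recursive functions -/

theorem definable_none : Definable fun _ => Part.none :=
  ⟨[], by simp, by simp⟩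

theorem Definable.of_clauses₀ {h : ℕ →. ℕ} (S : List Clause) (hS : ∀ C ∈ S, C.Valid)
    (H : ∀ Q : List Clause, S ⊆ Q → (∀ x y, Derives Q pairRel x y (Nat.pair x y)) →
      ∀ x, ∀ y ∈ h x, Derives Q (graph h) x y 0) : Definable h :=
  Definable.of_clauses definable_none definable_none S hS fun Q h₁ h₂ _ _ => H Q h₁ h₂

theorem definable_zero : Definable (pure 0) := by
  let C : Clause := ⟨[], ⟨graph (pure 0), var 0, zero, zero⟩⟩
  refine .of_clauses₀ [C] ?_ fun Q hQ _ x y hy => ?_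
  · simp only [List.forall_mem_singleton]
    intro ρ _
    exact Part.mem_some _
  · obtain rfl : y = 0 := Part.mem_some_iff.1 hy
    exact .rule C (hQ (by simp)) ![x, 0, 0, 0, 0, 0] (by simp [C])

theorem definable_succ : Definable Nat.succ := by
  let C : Clause := ⟨[], ⟨graph Nat.succ, var 0, succ (var 0), zero⟩⟩
  refine .of_clauses₀ [C] ?_ fun Q hQ _ x y hy => ?_
  · simp only [List.forall_mem_singleton]
    intro ρ _
    exact Part.mem_some _
  · obtain rfl : y = x.succ := Part.mem_some_iff.1 hy
    exact .rule C (hQ (by simp)) ![x, 0, 0, 0, 0, 0] (by simp [C])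

theorem definable_left : Definable fun n : ℕ => (n.unpair.1 : ℕ) := by
  let C : Clause := ⟨[⟨pairRel, var 0, var 1, var 2⟩],
    ⟨graph fun n : ℕ => (n.unpair.1 : ℕ), var 2, var 0, zero⟩⟩
  refine .of_clauses₀ [C] ?_ fun Q hQ hp x y hy => ?_
  · simp only [List.forall_mem_singleton]
    intro ρ h
    have h : Nat.pair (ρ 0) (ρ 1) = ρ 2 := h _ (List.mem_singleton_self _)
    simp [C, Atom.Holds, graph, Tm.eval, ← h]
  · obtain rfl := Part.mem_some_iff.1 hy
    exact .rule C (hQ (by simp)) ![x.unpair.1, x.unpair.2, x, 0, 0, 0]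
      (by simpa [C, Tm.eval] using hp x.unpair.1 x.unpair.2)

theorem definable_right : Definable fun n : ℕ => (n.unpair.2 : ℕ) := by
  let C : Clause := ⟨[⟨pairRel, var 0, var 1, var 2⟩],
    ⟨graph fun n : ℕ => (n.unpair.2 : ℕ), var 2, var 1, zero⟩⟩
  refine .of_clauses₀ [C] ?_ fun Q hQ hp x y hy => ?_
  · simp only [List.forall_mem_singleton]
    intro ρ h
    have h : Nat.pair (ρ 0) (ρ 1) = ρ 2 := h _ (List.mem_singleton_self _)
    simp [C, Atom.Holds, graph, Tm.eval, ← h]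
  · obtain rfl := Part.mem_some_iff.1 hy
    exact .rule C (hQ (by simp)) ![x.unpair.1, x.unpair.2, x, 0, 0, 0]
      (by simpa [C, Tm.eval] using hp x.unpair.1 x.unpair.2)

theorem Definable.pair {f g : ℕ →. ℕ} (hf : Definable f) (hg : Definable g) :
    Definable fun n => Nat.pair <$> f n <*> g n := by
  let C : Clause := ⟨[⟨graph f, var 0, var 1, zero⟩, ⟨graph g, var 0, var 2, zero⟩,
    ⟨pairRel, var 1, var 2, var 3⟩],
    ⟨graph fun n => Nat.pair <$> f n <*> g n, var 0, var 3, zero⟩⟩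
  refine .of_clauses hf hg [C] ?_ fun Q hQ hp hf hg x y hy => ?_
  · simp only [List.forall_mem_singleton]
    intro ρ h
    simp only [C, Atom.Holds, graph, Tm.eval, List.forall_mem_cons, pairRel] at h ⊢
    simp only [Seq.seq, Part.map_eq_map, Part.mem_bind_iff, Part.mem_map_iff]
    exact ⟨_, ⟨_, h.1, rfl⟩, _, h.2.1, h.2.2.1⟩
  · simp only [Seq.seq, Part.map_eq_map, Part.mem_bind_iff, Part.mem_map_iff] at hy
    obtain ⟨_, ⟨a, ha, rfl⟩, b, hb, rfl⟩ := hy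
    exact .rule C (hQ (by simp)) ![x, a, b, Nat.pair a b, 0, 0]
      (by simpa [C, Tm.eval] using ⟨hf _ _ ha, hg _ _ hb, hp a b⟩)

theorem Definable.comp {f g : ℕ →. ℕ} (hf : Definable f) (hg : Definable g) :
    Definable fun n => g n >>= f := by
  let C : Clause := ⟨[⟨graph g, var 0, var 1, zero⟩, ⟨graph f, var 1, var 2, zero⟩],
    ⟨graph fun n => g n >>= f, var 0, var 2, zero⟩⟩
  refine .of_clauses hf hg [C] ?_ fun Q hQ hp hf hg x y hy => ?_
  · simp only [List.forall_mem_singleton]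
    intro ρ h
    simp only [C, Atom.Holds, graph, Tm.eval, List.forall_mem_cons] at h ⊢
    exact Part.mem_bind h.1 h.2.1
  · obtain ⟨a, ha, hy⟩ := Part.mem_bind_iff.1 hy
    exact .rule C (hQ (by simp)) ![x, a, y, 0, 0, 0]
      (by simpa [C, Tm.eval] using ⟨hg _ _ ha, hf _ _ hy⟩)

/-- Primitive recursion of partial functions. -/
def precFun (f g : ℕ →. ℕ) (a n : ℕ) : Part ℕ :=
  n.rec (f a) fun y IH => do let i ← IH; g (Nat.pair a (Nat.pair y i))

theorem Definable.prec {f g : ℕ →. ℕ} (hf : Definable f) (hg : Definable g) :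
    Definable (Nat.unpaired (precFun f g)) := by
  let r : ℕ → ℕ → ℕ → Prop := fun a n i => i ∈ precFun f g a n
  let C₀ : Clause := ⟨[⟨graph f, var 0, var 1, zero⟩], ⟨r, var 0, zero, var 1⟩⟩
  let C₁ : Clause := ⟨[⟨r, var 0, var 1, var 2⟩, ⟨pairRel, var 1, var 2, var 3⟩,
    ⟨pairRel, var 0, var 3, var 4⟩, ⟨graph g, var 4, var 5, zero⟩],
    ⟨r, var 0, succ (var 1), var 5⟩⟩
  let C₂ : Clause := ⟨[⟨r, var 0, var 1, var 2⟩, ⟨pairRel, var 0, var 1, var 3⟩],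
    ⟨graph (Nat.unpaired (precFun f g)), var 3, var 2, zero⟩⟩
  refine .of_clauses hf hg [C₀, C₁, C₂] ?_ fun Q hQ hp hf hg x y hy => ?_
  · simp only [List.forall_mem_cons, List.not_mem_nil, false_imp_iff, implies_true, and_true]
    refine ⟨fun ρ h => ?_, fun ρ h => ?_, fun ρ h => ?_⟩
    · exact h ⟨graph f, var 0, var 1, zero⟩ (List.mem_singleton_self _)
    · simp only [C₁, r, Atom.Holds, graph, Tm.eval, List.forall_mem_cons, pairRel] at h ⊢
      obtain ⟨h₁, h₂, h₃, h₄, -⟩ := h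
      refine Part.mem_bind h₁ ?_
      rw [h₂, h₃]
      exact h₄
    · simp only [C₂, r, Atom.Holds, graph, Tm.eval, List.forall_mem_cons, pairRel] at h ⊢
      obtain ⟨h₁, h₂, -⟩ := h
      simpa [← h₂] using h₁
  · have key : ∀ a n, ∀ i ∈ precFun f g a n, Derives Q r a n i := by
      intro a n
      induction n with
      | zero =>
        intro i hi
        exact .rule C₀ (hQ (by simp)) ![a, i, 0, 0, 0, 0] (by simpa [C₀, Tm.eval] using hf _ _ hi)
      | succ n ih =>
        intro j hj
        obtain ⟨i, hi, hj⟩ := Part.mem_bind_iff.1 hj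
        exact .rule C₁ (hQ (by simp)) ![a, n, i, Nat.pair n i, Nat.pair a (Nat.pair n i), j]
          (by simpa [C₁, Tm.eval] using ⟨ih i hi, hp _ _, hp _ _, hg _ _ hj⟩)
    exact .rule C₂ (hQ (by simp)) ![x.unpair.1, x.unpair.2, y, x, 0, 0]
      (by simpa [C₂, Tm.eval] using ⟨key _ _ _ hy, by simpa using hp x.unpair.1 x.unpair.2⟩)

theorem Definable.rfind {f : ℕ →. ℕ} (hf : Definable f) :
    Definable fun a => Nat.rfind fun n => (fun m => m = 0) <$> f (Nat.pair a n) := by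
  -- Horn clauses have no negation or bounded quantifier, so an auxiliary predicate records that the
  -- search has met only nonzero values `m + 1` below `n`.
  let r : ℕ → ℕ → ℕ → Prop := fun a n _ => ∀ k < n, ∃ m, m + 1 ∈ f (Nat.pair a k)
  let C₀ : Clause := ⟨[], ⟨r, var 0, zero, zero⟩⟩
  let C₁ : Clause := ⟨[⟨r, var 0, var 1, zero⟩, ⟨pairRel, var 0, var 1, var 2⟩,
    ⟨graph f, var 2, succ (var 3), zero⟩], ⟨r, var 0, succ (var 1), zero⟩⟩
  let C₂ : Clause := ⟨[⟨r, var 0, var 1, zero⟩, ⟨pairRel, var 0, var 1, var 2⟩,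
    ⟨graph f, var 2, zero, zero⟩],
    ⟨graph fun a => Nat.rfind fun n => (fun m => m = 0) <$> f (Nat.pair a n),
      var 0, var 1, zero⟩⟩
  have mem_iff : ∀ a n, (n ∈ Nat.rfind fun n => (fun m => (m = 0 : Bool)) <$> f (Nat.pair a n)) ↔
      0 ∈ f (Nat.pair a n) ∧ r a n 0 := by
    intro a n
    refine Nat.mem_rfind.trans ?_
    simp only [Part.map_eq_map, Part.mem_map_iff, r]
    refine and_congr (by simp) (forall_congr' fun k => forall_congr' fun _ => ?_)
    constructor
    · rintro ⟨m, hm, hm'⟩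
      obtain ⟨m, rfl⟩ := Nat.exists_eq_succ_of_ne_zero (by simpa using hm' : m ≠ 0)
      exact ⟨m, hm⟩
    · rintro ⟨m, hm⟩
      exact ⟨_, hm, by simp⟩
  refine .of_clauses hf hf [C₀, C₁, C₂] ?_ fun Q hQ hp hf _ x y hy => ?_
  · simp only [List.forall_mem_cons, List.not_mem_nil, false_imp_iff, implies_true, and_true]
    refine ⟨fun ρ h => ?_, fun ρ h => ?_, fun ρ h => ?_⟩
    · exact fun k hk => absurd hk (Nat.not_lt_zero _)
    · simp only [C₁, Atom.Holds, graph, Tm.eval, List.forall_mem_cons, pairRel] at h ⊢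
      obtain ⟨h₁, h₂, h₃, -⟩ := h
      intro k hk
      rcases Nat.lt_succ_iff_lt_or_eq.1 hk with hk | rfl
      · exact h₁ k hk
      · exact ⟨_, h₂ ▸ h₃⟩
    · simp only [C₂, Atom.Holds, graph, Tm.eval, List.forall_mem_cons, pairRel] at h ⊢
      obtain ⟨h₁, h₂, h₃, -⟩ := h
      exact (mem_iff _ _).2 ⟨h₂ ▸ h₃, h₁⟩
  · obtain ⟨h₀, hlt⟩ := (mem_iff _ _).1 hy
    have key : ∀ n ≤ y, Derives Q r x n 0 := by
      intro n
      induction n with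
      | zero => exact fun _ => .rule C₀ (hQ (by simp)) ![x, 0, 0, 0, 0, 0] (by simp [C₀])
      | succ n ih =>
        intro hn
        obtain ⟨m, hm⟩ := hlt n hn
        exact .rule C₁ (hQ (by simp)) ![x, n, Nat.pair x n, m, 0, 0]
          (by simpa [C₁, Tm.eval] using ⟨ih (by omega), hp _ _, hf _ _ hm⟩)
    exact .rule C₂ (hQ (by simp)) ![x, y, Nat.pair x y, 0, 0, 0]
      (by simpa [C₂, Tm.eval] using ⟨key y le_rfl, hp _ _, hf _ _ h₀⟩)

theorem definable_of_partrec {f : ℕ →. ℕ} (hf : Nat.Partrec f) : Definable f := by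
  induction hf with
  | zero => exact definable_zero
  | succ => exact definable_succ
  | left => exact definable_left
  | right => exact definable_right
  | pair _ _ hf hg => exact hf.pair hg
  | comp _ _ hf hg => exact hf.comp hg
  | prec _ _ hf hg => exact hf.prec hg
  | rfind _ hf => exact hf.rfind

end Horn

/-! ### Derived connectives and provability in normal logics -/

namespace UForm

/-- `⊥`, as `p₀ ∧ ¬p₀`. -/
def bot : UForm := and (var 0) (neg (var 0))

/-- `⊤`. -/
def top : UForm := neg bot

/-- `◇φ`, the dual of the box. -/
def dia (φ : UForm) : UForm := neg (box (neg φ))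

/-- The biconditional. -/
def equi (φ ψ : UForm) : UForm := and (imp φ ψ) (imp ψ φ)

/-- If `γ` then `φ`, else `ψ`. -/
def cond (γ φ ψ : UForm) : UForm := neg (and (imp γ (neg φ)) (imp (neg γ) (neg ψ)))

/-- The conjunction of a list of formulas. -/
def conj : List UForm → UForm
  | [] => top
  | φ :: l => and φ (conj l)

/-- A truth assignment respecting the Boolean connectives. -/
structure IsBoolean (e : UForm → Prop) : Prop where
  neg : ∀ ψ, e (neg ψ) ↔ ¬ e ψ
  and : ∀ ψ χ, e (and ψ χ) ↔ (e ψ ∧ e χ)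

namespace IsBoolean

variable {e : UForm → Prop}

theorem imp (h : IsBoolean e) (φ ψ : UForm) : e (imp φ ψ) ↔ (e φ → e ψ) := by
  simp only [UForm.imp, h.neg, h.and]; tauto

theorem equi (h : IsBoolean e) (φ ψ : UForm) : e (equi φ ψ) ↔ (e φ ↔ e ψ) := by
  simp only [UForm.equi, h.imp, h.and]; tauto

theorem cond (h : IsBoolean e) (γ φ ψ : UForm) :
    e (cond γ φ ψ) ↔ (e γ ∧ e φ ∨ ¬ e γ ∧ e ψ) := by
  simp only [UForm.cond, h.imp, h.and, h.neg]; tauto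

theorem top (h : IsBoolean e) : e top := by
  simp only [UForm.top, bot, h.and, h.neg]; tauto

theorem conj (h : IsBoolean e) (l : List UForm) : e (conj l) ↔ ∀ φ ∈ l, e φ := by
  induction l with
  | nil => simpa [UForm.conj] using h.top
  | cons φ l ih => simp [UForm.conj, h.and, ih]

end IsBoolean

theorem subst_conj (σ : ℕ → UForm) (l : List UForm) (h0 : σ 0 = var 0) :
    subst σ (conj l) = conj (l.map (subst σ)) := by
  induction l with
  | nil => simp [conj, top, bot, subst, h0]
  | cons φ l ih => simp [conj, subst, ih]

theorem subst_imp (σ : ℕ → UForm) (φ ψ : UForm) :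
    subst σ (imp φ ψ) = imp (subst σ φ) (subst σ ψ) := rfl

end UForm

open UForm

namespace IsNormalLogicU

variable {L : Set UForm}

theorem taut_of (hL : IsNormalLogicU L) {φ : UForm} (h : ∀ e, IsBoolean e → e φ) : φ ∈ L :=
  hL.taut φ fun e h₁ h₂ => h e ⟨h₁, h₂⟩

theorem taut_of₁ (hL : IsNormalLogicU L) {φ χ : UForm} (hφ : φ ∈ L)
    (h : ∀ e, IsBoolean e → e φ → e χ) : χ ∈ L :=
  hL.mp _ _ (hL.taut_of fun e he => (he.imp _ _).2 (h e he)) hφ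

theorem taut_of₂ (hL : IsNormalLogicU L) {φ ψ χ : UForm} (hφ : φ ∈ L) (hψ : ψ ∈ L)
    (h : ∀ e, IsBoolean e → e φ → e ψ → e χ) : χ ∈ L :=
  hL.mp _ _ (hL.taut_of₁ hφ fun e he h₁ => (he.imp _ _).2 (h e he h₁)) hψ

theorem imp_trans (hL : IsNormalLogicU L) {φ ψ χ : UForm} (h₁ : imp φ ψ ∈ L)
    (h₂ : imp ψ χ ∈ L) : imp φ χ ∈ L :=
  hL.taut_of₂ h₁ h₂ fun e he => by simp only [he.imp]; tauto

/-- The substitution of `φ` for `p₀` and `ψ` for all other variables. -/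
def pairSubst (φ ψ : UForm) : ℕ → UForm
  | 0 => φ
  | _ + 1 => ψ

theorem box_imp (hL : IsNormalLogicU L) (φ ψ : UForm) :
    imp (box (imp φ ψ)) (imp (box φ) (box ψ)) ∈ L :=
  hL.subst_mem (pairSubst φ ψ) _ hL.box_K

theorem univ_imp (hL : IsNormalLogicU L) (φ ψ : UForm) :
    imp (univ (imp φ ψ)) (imp (univ φ) (univ ψ)) ∈ L :=
  hL.subst_mem (pairSubst φ ψ) _ hL.univ_K

theorem univ_four (hL : IsNormalLogicU L) (φ : UForm) : imp (univ φ) (univ (univ φ)) ∈ L :=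
  hL.subst_mem (fun _ => φ) _ hL.univ_4

theorem univ_symm (hL : IsNormalLogicU L) (φ : UForm) : imp φ (univ (exist φ)) ∈ L :=
  hL.subst_mem (fun _ => φ) _ hL.univ_B

theorem univ_imp_box (hL : IsNormalLogicU L) (φ : UForm) : imp (univ φ) (box φ) ∈ L :=
  hL.subst_mem (fun _ => φ) _ hL.univ_box

theorem univ_mono (hL : IsNormalLogicU L) {φ ψ : UForm} (h : imp φ ψ ∈ L) :
    imp (univ φ) (univ ψ) ∈ L :=
  hL.mp _ _ (hL.univ_imp φ ψ) (hL.nec_univ _ h)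

/-- A formula is global in `L` if `L` proves it to be constant across the universal modality. -/
def Global (L : Set UForm) (φ : UForm) : Prop :=
  imp φ (univ φ) ∈ L ∧ imp (neg φ) (univ (neg φ)) ∈ L

/-- The S5 laws for `∀`: symmetry gives `∃φ → ∀∃∃φ`, where transitivity collapses `∃∃`; the negative
half is transitivity alone. -/
theorem global_exist (hL : IsNormalLogicU L) (φ : UForm) : Global L (exist φ) := by
  constructor
  · refine hL.imp_trans (hL.univ_symm _) (hL.univ_mono ?_)
    have h : imp (univ (neg φ)) (univ (neg (exist φ))) ∈ L :=
      hL.imp_trans (hL.univ_four _) (hL.univ_mono (hL.taut_of fun e he => by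
        simp only [exist, he.imp, he.neg]; tauto))
    refine hL.taut_of₁ h fun e he => ?_
    simp only [exist, he.imp, he.neg]; tauto
  · have h : imp (univ (neg φ)) (univ (neg (exist φ))) ∈ L :=
      hL.imp_trans (hL.univ_four _) (hL.univ_mono (hL.taut_of fun e he => by
        simp only [exist, he.imp, he.neg]; tauto))
    refine hL.taut_of₁ h fun e he => ?_
    simp only [exist, he.imp, he.neg]; tauto

theorem global_and (hL : IsNormalLogicU L) {φ ψ : UForm} (hφ : Global L φ) (hψ : Global L ψ) :
    Global L (and φ ψ) := by
  constructor
  · have h₁ : imp (univ φ) (univ (imp ψ (and φ ψ))) ∈ L :=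
      hL.univ_mono (hL.taut_of fun e he => by simp only [he.imp, he.and]; tauto)
    have h₂ := hL.imp_trans h₁ (hL.univ_imp _ _)
    have h₃ := hL.imp_trans hφ.1 h₂
    refine hL.taut_of₂ h₃ hψ.1 fun e he => ?_
    simp only [he.imp, he.and]; tauto
  · have h₁ : imp (univ (neg φ)) (univ (neg (and φ ψ))) ∈ L :=
      hL.univ_mono (hL.taut_of fun e he => by simp only [he.imp, he.and, he.neg]; tauto)
    have h₂ : imp (univ (neg ψ)) (univ (neg (and φ ψ))) ∈ L :=
      hL.univ_mono (hL.taut_of fun e he => by simp only [he.imp, he.and, he.neg]; tauto)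
    refine hL.taut_of₂ (hL.imp_trans hφ.2 h₁) (hL.imp_trans hψ.2 h₂) fun e he => ?_
    simp only [he.imp, he.and, he.neg]; tauto

theorem global_top (hL : IsNormalLogicU L) : Global L top := by
  have h : univ top ∈ L := hL.nec_univ _ (hL.taut_of fun e he => he.top)
  exact ⟨hL.taut_of₁ h fun e he => by simp only [he.imp]; tauto,
    hL.taut_of fun e he => by simp only [he.imp, he.neg, he.top]; tauto⟩

theorem global_conj (hL : IsNormalLogicU L) {l : List UForm} (h : ∀ φ ∈ l, Global L φ) :
    Global L (conj l) := by
  induction l with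
  | nil => exact hL.global_top
  | cons φ l ih =>
    exact hL.global_and (h φ (by simp)) (ih fun ψ hψ => h ψ (by simp [hψ]))

/-- Replacement of provably equivalent formulas under a global assumption. -/
theorem subst_equi (hL : IsNormalLogicU L) {γ : UForm} (hγ : imp γ (univ γ) ∈ L)
    {σ τ : ℕ → UForm} (h : ∀ n, imp γ (equi (σ n) (τ n)) ∈ L) (φ : UForm) :
    imp γ (equi (subst σ φ) (subst τ φ)) ∈ L := by
  -- Since `γ` implies `∀γ`, an equivalence under `γ` holds at all points, and so passes under both
  -- `□` and `∀`.
  have lift : ∀ {φ ψ : UForm}, imp γ (equi φ ψ) ∈ L →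
      imp γ (univ (imp φ ψ)) ∈ L ∧ imp γ (univ (imp ψ φ)) ∈ L := fun {φ ψ} h =>
    ⟨hL.imp_trans hγ (hL.univ_mono (hL.taut_of₁ h fun e he => by
        simp only [he.imp, he.equi]; tauto)),
      hL.imp_trans hγ (hL.univ_mono (hL.taut_of₁ h fun e he => by
        simp only [he.imp, he.equi]; tauto))⟩
  induction φ with
  | var n => exact h n
  | neg φ ih =>
    exact hL.taut_of₁ ih fun e he => by simp only [subst, he.imp, he.equi, he.neg]; tauto
  | and φ ψ ih₁ ih₂ =>
    exact hL.taut_of₂ ih₁ ih₂ fun e he => by simp only [subst, he.imp, he.equi, he.and]; tauto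
  | box φ ih =>
    have h₁ := hL.imp_trans (hL.imp_trans (lift ih).1 (hL.univ_imp_box _)) (hL.box_imp _ _)
    have h₂ := hL.imp_trans (hL.imp_trans (lift ih).2 (hL.univ_imp_box _)) (hL.box_imp _ _)
    exact hL.taut_of₂ h₁ h₂ fun e he => by simp only [subst, he.imp, he.equi]; tauto
  | univ φ ih =>
    have h₁ := hL.imp_trans (lift ih).1 (hL.univ_imp _ _)
    have h₂ := hL.imp_trans (lift ih).2 (hL.univ_imp _ _)
    exact hL.taut_of₂ h₁ h₂ fun e he => by simp only [subst, he.imp, he.equi]; tauto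

/-- Some substitution fixing `p₀` turns `η` into a formula that implies `ψ` in `L`. -/
def Enforces (L : Set UForm) (η ψ : UForm) : Prop :=
  ∃ σ : ℕ → UForm, σ 0 = var 0 ∧ imp (subst σ η) ψ ∈ L

/-- If `η` enforces a global formula `ψ`, which in turn makes an instance of `η` imply `χ`,
then `η` enforces `χ`: the two substitutions are combined by a case distinction on `ψ`. -/
theorem Enforces.step (hL : IsNormalLogicU L) {η ψ χ : UForm} (hψ : Global L ψ)
    (h : Enforces L η ψ) {τ : ℕ → UForm} (hτ : τ 0 = var 0)
    (hχ : imp (and ψ (subst τ η)) χ ∈ L) : Enforces L η χ := by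
  obtain ⟨σ, hσ, h⟩ := h
  -- Under `ψ` the merged substitution acts as `τ`, which gives `χ`. Under `¬ψ` it acts as `σ`, so
  -- the instance of `η` would imply `ψ` and is therefore false. Fixing `p₀` keeps `⊥`, and with it
  -- all closed formulas, syntactically unchanged.
  let ρ : ℕ → UForm := fun n => if n = 0 then var 0 else cond ψ (τ n) (σ n)
  refine ⟨ρ, rfl, ?_⟩
  have h₁ : imp ψ (equi (subst ρ η) (subst τ η)) ∈ L := by
    refine hL.subst_equi hψ.1 (fun n => ?_) η
    rcases Nat.eq_zero_or_pos n with rfl | hn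
    · exact hL.taut_of fun e he => by simp [ρ, hτ, he.imp, he.equi]
    · refine hL.taut_of fun e he => ?_
      simp only [ρ, hn.ne', if_false, he.imp, he.equi, he.cond]; tauto
  have h₂ : imp (neg ψ) (equi (subst ρ η) (subst σ η)) ∈ L := by
    refine hL.subst_equi hψ.2 (fun n => ?_) η
    rcases Nat.eq_zero_or_pos n with rfl | hn
    · exact hL.taut_of fun e he => by simp [ρ, hσ, he.imp, he.equi]
    · refine hL.taut_of fun e he => ?_
      simp only [ρ, hn.ne', if_false, he.imp, he.equi, he.cond, he.neg]; tauto
  have h₃ : imp ψ (imp (subst ρ η) χ) ∈ L := hL.taut_of₂ h₁ hχ fun e he => by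
    simp only [he.imp, he.equi, he.and]; tauto
  have h₄ : imp (neg ψ) (neg (subst ρ η)) ∈ L := hL.taut_of₂ h₂ h fun e he => by
    simp only [he.imp, he.equi, he.neg]; tauto
  exact hL.taut_of₂ h₃ h₄ fun e he => by simp only [he.imp, he.neg]; tauto

theorem Enforces.conj (hL : IsNormalLogicU L) {η : UForm} {l : List UForm}
    (hg : ∀ φ ∈ l, Global L φ) (h : ∀ φ ∈ l, Enforces L η φ) : Enforces L η (conj l) := by
  induction l with
  | nil => exact ⟨var, rfl, hL.taut_of fun e he => by simp [UForm.conj, he.imp, he.top]⟩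
  | cons φ l ih =>
    obtain ⟨τ, hτ, h'⟩ := ih (fun ψ hψ => hg ψ (by simp [hψ])) fun ψ hψ => h ψ (by simp [hψ])
    refine Enforces.step hL (hg φ (by simp)) (h φ (by simp)) hτ ?_
    exact hL.taut_of₁ h' fun e he => by simp only [UForm.conj, he.imp, he.and]; tauto

end IsNormalLogicU

/-! ### Formulas describing Horn programs -/

namespace UForm

open Horn

/-- "Dead end". -/
def dead : UForm := box bot

/-- "Not a dead end and sees no dead end". -/
def loop : UForm := and (neg dead) (neg (dia dead))

/-- Formula describing the points of the number chain. -/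
def chain : UForm := and (neg (dia loop)) (dia dead)

/-- Formulas measuring the depth of marker points. -/
def depth : ℕ → UForm
  | 0 => and (dia loop) (dia dead)
  | i + 1 => dia (depth i)

/-- The modal formula of a term. -/
def ofTm : Tm → UForm
  | .zero => top
  | .var v => var (v + 1)
  | .succ t => dia (and chain (ofTm t))

/-- "The argument in position `i` is the least chain point satisfying `φ`". -/
def slot (i : ℕ) (φ : UForm) : UForm :=
  dia (and (and (depth i) (neg (depth (i + 1))))
    (and (dia (and chain φ)) (neg (dia (dia (and chain φ))))))

/-- "There is a fact with the given arguments". -/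
def fact (t : Fin 4 → Tm) : UForm :=
  exist (and (and (slot 0 (ofTm (t 0))) (slot 1 (ofTm (t 1))))
    (and (slot 2 (ofTm (t 2))) (slot 3 (ofTm (t 3)))))

/-- "The term has a value". -/
def guard (t : Tm) : UForm := exist (and chain (ofTm t))

/-- The modal formula of an atom, where `idx` numbers the predicate symbols. -/
def ofAtom (idx : (ℕ → ℕ → ℕ → Prop) → ℕ) (A : Atom) : UForm :=
  fact ![Tm.ofNat (idx A.rel), A.fst, A.snd, A.trd]

/-- The premises of a clause, together with guards for the variables. -/
def clausePrems (idx : (ℕ → ℕ → ℕ → Prop) → ℕ) (C : Clause) : List UForm :=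
  (List.finRange 6).map (fun v => guard (.var v)) ++ C.prems.map (ofAtom idx)

/-- The modal formula of a clause. -/
def ofClause (idx : (ℕ → ℕ → ℕ → Prop) → ℕ) (C : Clause) : UForm :=
  imp (conj (clausePrems idx C)) (ofAtom idx C.concl)

/-- The modal formula of a Horn program. -/
def ofProgram (idx : (ℕ → ℕ → ℕ → Prop) → ℕ) (P : List Clause) : UForm :=
  conj (guard .zero :: imp (guard (.var 0)) (guard (.succ (.var 0))) :: P.map (ofClause idx))

/-! ### Effect of numeral substitutions on the describing formulas -/

section Subst

variable {σ : ℕ → UForm}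

theorem subst_chain (h : σ 0 = var 0) : subst σ chain = chain := by
  simp [chain, loop, dead, dia, bot, subst, h]

theorem subst_depth (h : σ 0 = var 0) (i : ℕ) : subst σ (depth i) = depth i := by
  induction i with
  | zero => simp [depth, loop, dead, dia, bot, subst, h]
  | succ i ih => simp [depth, dia, subst, ih]

theorem subst_slot (h : σ 0 = var 0) (i : ℕ) (φ : UForm) :
    subst σ (slot i φ) = slot i (subst σ φ) := by
  simp [slot, dia, subst, subst_chain h, subst_depth h]

theorem subst_ofTm (h : σ 0 = var 0) {ρ : Fin 6 → ℕ}
    (hρ : ∀ v : Fin 6, σ (v + 1) = ofTm (Tm.ofNat (ρ v))) (t : Tm) :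
    subst σ (ofTm t) = ofTm (Tm.ofNat (t.eval ρ)) := by
  induction t with
  | zero => simp [ofTm, top, bot, subst, h, Tm.eval, Tm.ofNat]
  | var v => simp [ofTm, subst, hρ, Tm.eval]
  | succ t ih => simp [ofTm, dia, subst, subst_chain h, ih, Tm.eval, Tm.ofNat]

theorem subst_numeral (h : σ 0 = var 0) (n : ℕ) :
    subst σ (ofTm (Tm.ofNat n)) = ofTm (Tm.ofNat n) := by
  induction n with
  | zero => simp [ofTm, top, bot, subst, h, Tm.ofNat]
  | succ t ih => simp [ofTm, dia, subst, subst_chain h, ih, Tm.ofNat]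

theorem subst_fact (h : σ 0 = var 0) {ρ : Fin 6 → ℕ}
    (hρ : ∀ v : Fin 6, σ (v + 1) = ofTm (Tm.ofNat (ρ v))) (t : Fin 4 → Tm) :
    subst σ (fact t) = fact fun i => Tm.ofNat ((t i).eval ρ) := by
  simp [fact, exist, subst, subst_slot h, subst_ofTm h hρ]

theorem subst_fact_numeral (h : σ 0 = var 0) (x : Fin 4 → ℕ) :
    subst σ (fact fun i => Tm.ofNat (x i)) = fact fun i => Tm.ofNat (x i) := by
  simp [fact, exist, subst, subst_slot h, subst_numeral h]

theorem subst_guard (h : σ 0 = var 0) {ρ : Fin 6 → ℕ}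
    (hρ : ∀ v : Fin 6, σ (v + 1) = ofTm (Tm.ofNat (ρ v))) (t : Tm) :
    subst σ (guard t) = guard (Tm.ofNat (t.eval ρ)) := by
  simp [guard, exist, subst, subst_chain h, subst_ofTm h hρ]

theorem subst_ofAtom (h : σ 0 = var 0) {ρ : Fin 6 → ℕ}
    (hρ : ∀ v : Fin 6, σ (v + 1) = ofTm (Tm.ofNat (ρ v))) (idx : (ℕ → ℕ → ℕ → Prop) → ℕ)
    (A : Atom) : subst σ (ofAtom idx A) = fact fun i => Tm.ofNat
      ((![idx A.rel, A.fst.eval ρ, A.snd.eval ρ, A.trd.eval ρ] : Fin 4 → ℕ) i) := by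
  rw [ofAtom, subst_fact h hρ]
  congr 1
  funext i
  fin_cases i <;> simp [Tm.eval_ofNat]

end Subst

/-- The substitution of numerals for the variables of a clause. -/
def numSubst (ρ : Fin 6 → ℕ) : ℕ → UForm
  | 0 => var 0
  | n + 1 => if h : n < 6 then ofTm (Tm.ofNat (ρ ⟨n, h⟩)) else var 0

theorem numSubst_zero (ρ : Fin 6 → ℕ) : numSubst ρ 0 = var 0 := rfl

theorem numSubst_succ (ρ : Fin 6 → ℕ) (v : Fin 6) :
    numSubst ρ (v + 1) = ofTm (Tm.ofNat (ρ v)) := by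
  simp [numSubst]

/-! ### From derivations to unifiers -/

section Enforce

variable {L : Set UForm} {idx : (ℕ → ℕ → ℕ → Prop) → ℕ} {P : List Clause}

open IsNormalLogicU

theorem subst_ofProgram_imp (hL : IsNormalLogicU L) {σ : ℕ → UForm} (h : σ 0 = var 0)
    {φ : UForm} (hφ : φ ∈ guard .zero :: imp (guard (.var 0)) (guard (.succ (.var 0))) ::
      P.map (ofClause idx)) : imp (subst σ (ofProgram idx P)) (subst σ φ) ∈ L :=
  hL.taut_of fun e he => by
    rw [he.imp, ofProgram, subst_conj _ _ h, he.conj]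
    exact fun H => H _ (List.mem_map_of_mem hφ)

/-- The first two conjuncts of `ofProgram` serve this induction; its result discharges the guards on
clause variables whenever numerals are substituted for them. -/
theorem enforces_guard (hL : IsNormalLogicU L) (n : ℕ) :
    Enforces L (ofProgram idx P) (guard (Tm.ofNat n)) := by
  induction n with
  | zero =>
    refine ⟨numSubst fun _ => 0, rfl, ?_⟩
    have h := subst_ofProgram_imp (idx := idx) (P := P) hL (σ := numSubst fun _ => 0) rfl
      (φ := guard .zero) (by simp)
    rwa [subst_guard (numSubst_zero _) (numSubst_succ _)] at h
  | succ n ih =>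
    refine ih.step hL (hL.global_exist _) (τ := numSubst fun _ => n) rfl ?_
    have h := subst_ofProgram_imp (idx := idx) (P := P) hL (σ := numSubst fun _ => n) rfl
      (φ := imp (guard (.var 0)) (guard (.succ (.var 0)))) (by simp)
    rw [subst_imp, subst_guard (numSubst_zero _) (numSubst_succ _),
      subst_guard (numSubst_zero _) (numSubst_succ _)] at h
    exact hL.taut_of₁ h fun e he => by simp only [he.imp, he.and, Tm.eval]; tauto

theorem enforces_of_derives (hL : IsNormalLogicU L) {r : ℕ → ℕ → ℕ → Prop} {x y z : ℕ}
    (h : Derives P r x y z) : Enforces L (ofProgram idx P)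
      (fact fun i => Tm.ofNat ((![idx r, x, y, z] : Fin 4 → ℕ) i)) := by
  induction h with
  | rule C hC ρ _ ih =>
    let τ := numSubst ρ
    have h := subst_ofProgram_imp (idx := idx) (P := P) hL (σ := τ) rfl
      (φ := ofClause idx C)
      (List.mem_cons_of_mem _ (List.mem_cons_of_mem _ (List.mem_map_of_mem hC)))
    rw [ofClause, subst_imp, subst_conj _ _ (numSubst_zero _),
      subst_ofAtom (numSubst_zero _) (numSubst_succ _)] at h
    have hmem : ∀ φ ∈ (clausePrems idx C).map (subst τ),
        Global L φ ∧ Enforces L (ofProgram idx P) φ := by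
      intro φ hφ
      simp only [clausePrems, List.mem_map, List.mem_append] at hφ
      obtain ⟨_, ⟨v, -, rfl⟩ | ⟨A, hA, rfl⟩, rfl⟩ := hφ
      · rw [subst_guard (numSubst_zero _) (numSubst_succ _)]
        exact ⟨hL.global_exist _, enforces_guard hL _⟩
      · rw [subst_ofAtom (numSubst_zero _) (numSubst_succ _)]
        exact ⟨hL.global_exist _, ih A hA⟩
    -- The premises are already enforced and their conjunction is global; `τ` turns the clause
    -- itself into the missing implication.
    refine Enforces.step hL (hL.global_conj fun φ hφ => (hmem φ hφ).1)
      (Enforces.conj hL (fun φ hφ => (hmem φ hφ).1) fun φ hφ => (hmem φ hφ).2) (τ := τ) rfl ?_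
    exact hL.taut_of₁ h fun e he => by simp only [he.imp, he.and]; tauto

theorem unifiableIn_of_derives (hL : IsNormalLogicU L) {r : ℕ → ℕ → ℕ → Prop} {x y z : ℕ}
    (h : Derives P r x y z) : UnifiableIn L (imp (ofProgram idx P)
      (fact fun i => Tm.ofNat ((![idx r, x, y, z] : Fin 4 → ℕ) i))) := by
  obtain ⟨σ, hσ, h⟩ := enforces_of_derives (idx := idx) hL h
  exact ⟨σ, by rwa [subst_imp, subst_fact_numeral hσ]⟩

end Enforce

/-! ### Kripke semantics -/

section Semantics

variable {W : Type*}

/-- Truth at a point of a Kripke model; `∀` is interpreted by the whole set of points. -/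
def Sat (R : W → W → Prop) (V : ℕ → W → Prop) : UForm → W → Prop
  | var n, w => V n w
  | neg φ, w => ¬ Sat R V φ w
  | and φ ψ, w => Sat R V φ w ∧ Sat R V ψ w
  | box φ, w => ∀ u, R w u → Sat R V φ u
  | univ φ, _ => ∀ u, Sat R V φ u

variable (R : W → W → Prop) (V : ℕ → W → Prop)

theorem isBoolean_sat (w : W) : IsBoolean fun φ => Sat R V φ w :=
  ⟨fun _ => Iff.rfl, fun _ _ => Iff.rfl⟩

theorem sat_neg (φ : UForm) (w : W) : Sat R V (neg φ) w ↔ ¬ Sat R V φ w := Iff.rfl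

theorem sat_and (φ ψ : UForm) (w : W) :
    Sat R V (and φ ψ) w ↔ Sat R V φ w ∧ Sat R V ψ w := Iff.rfl

theorem sat_imp (φ ψ : UForm) (w : W) :
    Sat R V (imp φ ψ) w ↔ (Sat R V φ w → Sat R V ψ w) :=
  (isBoolean_sat R V w).imp φ ψ

theorem sat_conj (l : List UForm) (w : W) :
    Sat R V (conj l) w ↔ ∀ φ ∈ l, Sat R V φ w :=
  (isBoolean_sat R V w).conj l

theorem sat_top (w : W) : Sat R V top w :=
  (isBoolean_sat R V w).top

theorem sat_dia (φ : UForm) (w : W) : Sat R V (dia φ) w ↔ ∃ u, R w u ∧ Sat R V φ u := by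
  simp [dia, Sat]

theorem sat_exist (φ : UForm) (w : W) : Sat R V (exist φ) w ↔ ∃ u, Sat R V φ u := by
  simp [exist, Sat]

theorem sat_dead (w : W) : Sat R V dead w ↔ ∀ u, ¬ R w u := by
  simp [dead, bot, Sat]

theorem sat_subst (σ : ℕ → UForm) (φ : UForm) (w : W) :
    Sat R V (subst σ φ) w ↔ Sat R (fun n => Sat R V (σ n)) φ w := by
  induction φ generalizing w with
  | var n => rfl
  | neg φ ih => simp [subst, Sat, ih]
  | and φ ψ ih₁ ih₂ => simp [subst, Sat, ih₁, ih₂]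
  | box φ ih => simp [subst, Sat, ih]
  | univ φ ih => simp [subst, Sat, ih]

/-- The set of formulas valid in a frame. -/
def frameLogic : Set UForm := {φ | ∀ V w, Sat R V φ w}

theorem isNormalLogicU_frameLogic : IsNormalLogicU (frameLogic R) where
  taut φ h V w := h (fun ψ => Sat R V ψ w) (isBoolean_sat R V w).neg (isBoolean_sat R V w).and
  box_K V w := by simp only [sat_imp, Sat]; exact fun h₁ h₂ u hu => h₁ u hu (h₂ u hu)
  univ_K V w := by simp only [sat_imp, Sat]; exact fun h₁ h₂ u => h₁ u (h₂ u)
  univ_T V w := by simp only [sat_imp, Sat]; exact fun h => h w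
  univ_4 V w := by simp only [sat_imp, Sat]; exact fun h _ => h
  univ_B V w := by simp only [sat_imp, Sat, sat_exist]; exact fun h _ => ⟨w, h⟩
  univ_box V w := by simp only [sat_imp, Sat]; exact fun h u _ => h u
  mp φ ψ h₁ h₂ V w := (sat_imp ..).1 (h₁ V w) (h₂ V w)
  nec_box φ h V w u _ := h V u
  nec_univ φ h V w u := h V u
  subst_mem σ φ h V w := (sat_subst ..).2 (h _ w)

/-- Soundness of `K4_u` on transitive frames is all that the upper bound on `L` contributes. -/
theorem logicK4u_subset_frameLogic (hR : ∀ u v w, R u v → R v w → R u w) :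
    logicK4u ⊆ frameLogic R := by
  refine Set.sInter_subset_of_mem ⟨isNormalLogicU_frameLogic R, fun V w => ?_⟩
  simp only [sat_imp, Sat]
  exact fun h u hu v hv => h v (hR _ _ _ hu hv)

end Semantics

end UForm

/-! ### The frame of a set of facts -/

namespace FactFrame

open UForm Horn

/-- Points: the chain of natural numbers, markers, argument slots and facts. -/
inductive Pt : Type where
  | num : ℕ → Pt
  | mark : ℕ → Pt
  | arg : Fin 4 → ℕ → Pt
  | fct : (Fin 4 → ℕ) → Pt

open Pt

/-- The accessibility relation, for a given set `M` of facts. -/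
def Acc (M : (Fin 4 → ℕ) → Prop) : Pt → Pt → Prop
  | num n, num m => m < n
  | mark j, mark i => i < j ∨ i = 0 ∧ j = 0
  | mark j, num m => m = 0 ∧ 0 < j
  | arg _ n, num m => m ≤ n + 1
  | arg i _, mark j => j ≤ i
  | fct x, num m => M x ∧ ∃ i, m ≤ x i + 1
  | fct x, mark j => M x ∧ j ≤ 3
  | fct x, arg i n => M x ∧ n = x i
  | _, _ => False

variable (M : (Fin 4 → ℕ) → Prop)

/-- A fact point sees directly all chain points and markers below its argument points, which makes
the relation transitive. The only reflexive point is `mark 0`. -/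
theorem acc_trans (u v w : Pt) (h₁ : Acc M u v) (h₂ : Acc M v w) : Acc M u w := by
  cases u <;> cases v <;> simp only [Acc] at h₁ <;> cases w <;> simp only [Acc] at h₂ ⊢
  all_goals first
    | omega
    | exact ⟨h₁.1, by omega⟩
    | exact ⟨h₁.1, 0, by omega⟩
    | exact ⟨h₁.1, h₁.2.choose, by have := h₁.2.choose_spec; omega⟩
    | exact ⟨h₁.1, _, h₁.2 ▸ h₂⟩

variable (V : ℕ → Pt → Prop)

/-- Points `fct x` with `M x` false are dead ends too, but nothing sees them; hence the restriction
to points with a predecessor, which suffices under `◇`. -/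
theorem sat_dead_iff {w : Pt} {x : Pt} (hx : Acc M x w) :
    Sat (Acc M) V dead w ↔ w = num 0 := by
  rw [sat_dead]
  constructor
  · intro h
    rcases w with n | j | ⟨i, n⟩ | y
    · rcases n with _ | n
      · rfl
      · exact absurd (Nat.succ_pos n) (h (num 0))
    · exact absurd (show 0 < j ∨ 0 = 0 ∧ j = 0 by omega) (h (mark 0))
    · exact absurd (Nat.zero_le _) (h (num 0))
    · cases x <;> exact hx.elim
  · rintro rfl u hu
    cases u <;> simp [Acc] at hu

theorem sat_dia_dead (w : Pt) : Sat (Acc M) V (dia dead) w ↔ Acc M w (num 0) := by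
  rw [sat_dia]
  constructor
  · rintro ⟨u, hu, h⟩
    rwa [(sat_dead_iff M V hu).1 h] at hu
  · exact fun h => ⟨_, h, (sat_dead_iff M V h).2 rfl⟩

theorem sat_loop_iff {w : Pt} {x : Pt} (hx : Acc M x w) :
    Sat (Acc M) V loop w ↔ w = mark 0 := by
  rw [loop, sat_and, sat_neg, sat_neg, sat_dead_iff M V hx, sat_dia_dead]
  rcases w with n | j | ⟨i, n⟩ | y
  · simp [Acc, Nat.pos_iff_ne_zero]
  · simp [Acc]
  · simp [Acc]
  · cases x <;> exact hx.elim

theorem sat_dia_loop (w : Pt) : Sat (Acc M) V (dia loop) w ↔ Acc M w (mark 0) := by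
  rw [sat_dia]
  constructor
  · rintro ⟨u, hu, h⟩
    rwa [(sat_loop_iff M V hu).1 h] at hu
  · exact fun h => ⟨_, h, (sat_loop_iff M V h).2 rfl⟩

/-- The dead end `num 0` is not a chain point, so the number `n` is represented by `num (n + 1)`. -/
theorem sat_chain (w : Pt) : Sat (Acc M) V chain w ↔ ∃ n, w = num (n + 1) := by
  rw [chain, sat_and, sat_neg, sat_dia_loop, sat_dia_dead]
  rcases w with n | j | ⟨i, n⟩ | y
  · rcases n with _ | n <;> simp [Acc]
  · simp only [Acc, reduceCtorEq, exists_false, iff_false]; omega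
  · simp [Acc]
  · simp only [Acc, reduceCtorEq, exists_false, iff_false]
    exact fun h => h.1 ⟨h.2.1, by omega⟩

theorem sat_depth_num (i n : ℕ) : ¬ Sat (Acc M) V (depth i) (num n) := by
  induction i generalizing n with
  | zero => rw [depth, sat_and, sat_dia_loop]; simp [Acc]
  | succ i ih =>
    rw [depth, sat_dia]
    rintro ⟨u, hu, h⟩
    cases u
    · exact ih _ h
    all_goals exact hu.elim

theorem sat_depth_mark (i j : ℕ) : Sat (Acc M) V (depth i) (mark j) ↔ i < j := by
  induction i generalizing j with
  | zero =>
    rw [depth, sat_and, sat_dia_loop, sat_dia_dead]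
    simp only [Acc, true_and]; omega
  | succ i ih =>
    rw [depth, sat_dia]
    constructor
    · rintro ⟨u, hu, h⟩
      rcases u with n | k | ⟨i, n⟩ | y
      · exact (sat_depth_num M V _ _ h).elim
      · rw [ih] at h
        simp only [Acc] at hu; omega
      all_goals exact hu.elim
    · intro h
      exact ⟨mark (i + 1), Or.inl h, (ih _).2 (Nat.lt_succ_self _)⟩

theorem sat_depth_arg (i : ℕ) (j : Fin 4) (n : ℕ) :
    Sat (Acc M) V (depth i) (arg j n) ↔ i ≤ j := by
  rcases i with _ | i
  · rw [depth, sat_and, sat_dia_loop, sat_dia_dead]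
    simp [Acc]
  · rw [depth, sat_dia]
    constructor
    · rintro ⟨u, hu, h⟩
      rcases u with n | k | ⟨i, n⟩ | y
      · exact (sat_depth_num M V _ _ h).elim
      · rw [sat_depth_mark] at h
        simp only [Acc] at hu; omega
      all_goals exact hu.elim
    · intro h
      exact ⟨mark (i + 1), h, (sat_depth_mark ..).2 (Nat.lt_succ_self _)⟩

/-- The numbers whose chain points satisfy `φ`. -/
def nums (φ : UForm) : Set ℕ := {n | Sat (Acc M) V φ (num (n + 1))}

theorem sat_dia_chain (φ : UForm) (w : Pt) : Sat (Acc M) V (dia (and chain φ)) w ↔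
    ∃ n ∈ nums M V φ, Acc M w (num (n + 1)) := by
  simp only [sat_dia, sat_and, sat_chain, nums, Set.mem_ofPred_eq]
  constructor
  · rintro ⟨_, hu, ⟨n, rfl⟩, h⟩
    exact ⟨n, h, hu⟩
  · rintro ⟨n, h, hu⟩
    exact ⟨_, hu, ⟨n, rfl⟩, h⟩

/-- From `arg i n` the numbers up to `n` are visible in one step, but only those below `n` in two
steps: a marker leads to no chain point. -/
theorem sat_arg_least (φ : UForm) (i : Fin 4) (n : ℕ) :
    Sat (Acc M) V (and (dia (and chain φ)) (neg (dia (dia (and chain φ))))) (arg i n) ↔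
      IsLeast (nums M V φ) n := by
  rw [sat_and, sat_neg, sat_dia_chain, sat_dia]
  simp only [sat_dia_chain]
  constructor
  · rintro ⟨⟨m, hm, hmn⟩, h⟩
    simp only [Acc] at hmn
    have hlb : n ∈ lowerBounds (nums M V φ) := fun k hk => by
      by_contra hkn
      -- A smaller witness would be reached in two steps through the top point `num (n + 1)`.
      exact h ⟨num (n + 1), le_rfl, k, hk, show k + 1 < n + 1 by omega⟩
    obtain rfl : m = n := le_antisymm (by omega) (hlb hm)
    exact ⟨hm, hlb⟩
  · rintro ⟨hn, hlb⟩
    refine ⟨⟨n, hn, le_rfl⟩, ?_⟩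
    rintro ⟨u, hu, k, hk, huk⟩
    have := hlb hk
    rcases u with m | j | ⟨i, m⟩ | y
    · simp only [Acc] at hu huk; omega
    · simp only [Acc] at huk; omega
    all_goals exact hu.elim

theorem sat_slot (i : Fin 4) (φ : UForm) (w : Pt) : Sat (Acc M) V (slot i φ) w ↔
    ∃ x, w = fct x ∧ M x ∧ IsLeast (nums M V φ) (x i) := by
  rw [slot, sat_dia]
  simp only [sat_and _ _ (and _ (neg _))]
  constructor
  · rintro ⟨u, hu, ⟨hd, hd'⟩, h⟩
    rcases u with m | j | ⟨j, m⟩ | y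
    · exact (sat_depth_num M V _ _ hd).elim
    -- The marker `i + 1` has the same depth as the argument points of position `i`, but among the
    -- `num` points it sees only `num 0`.
    · obtain ⟨n, -, hn⟩ := (sat_dia_chain ..).1 ((sat_and ..).1 h).1
      simp only [Acc] at hn; omega
    · rw [sat_neg, sat_depth_arg] at hd'
      rw [sat_depth_arg] at hd
      obtain rfl : i = j := Fin.ext (by omega)
      rcases w with _ | _ | _ | x
      iterate 3 exact hu.elim
      rw [sat_arg_least] at h
      exact ⟨x, rfl, hu.1, hu.2 ▸ h⟩
    · cases w <;> exact hu.elim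
  · rintro ⟨x, rfl, hM, h⟩
    refine ⟨arg i (x i), ⟨hM, rfl⟩, ⟨(sat_depth_arg ..).2 le_rfl, ?_⟩, (sat_arg_least ..).2 h⟩
    rw [sat_neg, sat_depth_arg]; omega

theorem sat_fact (t : Fin 4 → Tm) (w : Pt) : Sat (Acc M) V (fact t) w ↔
    ∃ x, M x ∧ ∀ i, IsLeast (nums M V (ofTm (t i))) (x i) := by
  rw [fact, sat_exist]
  have h0 := sat_slot M V 0
  have h1 := sat_slot M V 1
  have h2 := sat_slot M V 2
  have h3 := sat_slot M V 3
  simp only [Fin.val_zero, Fin.val_one, Fin.val_two, show ((3 : Fin 4) : ℕ) = 3 from rfl]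
    at h0 h1 h2 h3
  simp only [sat_and, h0, h1, h2, h3]
  constructor
  · rintro ⟨_, ⟨⟨x, rfl, hM, hx0⟩, ⟨_, h, -, hx1⟩⟩, ⟨_, h', -, hx2⟩, ⟨_, h'', -, hx3⟩⟩
    -- All four slots are evaluated at one point, so they speak of the same tuple.
    cases h; cases h'; cases h''
    refine ⟨x, hM, fun i => ?_⟩
    fin_cases i <;> assumption
  · rintro ⟨x, hM, h⟩
    exact ⟨fct x, ⟨⟨x, rfl, hM, h 0⟩, ⟨x, rfl, hM, h 1⟩⟩, ⟨x, rfl, hM, h 2⟩, ⟨x, rfl, hM, h 3⟩⟩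

theorem sat_guard (t : Tm) (w : Pt) :
    Sat (Acc M) V (guard t) w ↔ (nums M V (ofTm t)).Nonempty := by
  simp only [UForm.guard, sat_exist, sat_and, sat_chain, nums]
  constructor
  · rintro ⟨_, ⟨n, rfl⟩, h⟩
    exact ⟨n, h⟩
  · rintro ⟨n, h⟩
    exact ⟨_, ⟨n, rfl⟩, h⟩

theorem isLeast_zero : IsLeast (nums M V (ofTm .zero)) 0 :=
  ⟨sat_top (Acc M) V _, fun _ _ => Nat.zero_le _⟩

theorem isLeast_succ {t : Tm} {n : ℕ} (h : IsLeast (nums M V (ofTm t)) n) :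
    IsLeast (nums M V (ofTm (.succ t))) (n + 1) := by
  simp only [IsLeast, nums, ofTm, lowerBounds, Set.mem_ofPred_eq] at h ⊢
  simp only [sat_dia_chain]
  refine ⟨⟨n, h.1, Nat.lt_succ_self _⟩, ?_⟩
  rintro m ⟨k, hk, hkm⟩
  have := h.2 hk
  simp only [Acc] at hkm; omega

theorem isLeast_eval {ρ : Fin 6 → ℕ} (hρ : ∀ v, IsLeast (nums M V (ofTm (.var v))) (ρ v))
    (t : Tm) : IsLeast (nums M V (ofTm t)) (t.eval ρ) := by
  induction t with
  | zero => exact isLeast_zero M V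
  | var v => exact hρ v
  | succ t ih => exact isLeast_succ M V ih

theorem isLeast_ofNat (n : ℕ) : IsLeast (nums M V (ofTm (Tm.ofNat n))) n := by
  induction n with
  | zero => exact isLeast_zero M V
  | succ n ih => exact isLeast_succ M V ih

theorem sat_fact_iff {t : Fin 4 → Tm} {x : Fin 4 → ℕ}
    (h : ∀ i, IsLeast (nums M V (ofTm (t i))) (x i)) (w : Pt) :
    Sat (Acc M) V (fact t) w ↔ M x := by
  rw [sat_fact]
  constructor
  · rintro ⟨y, hM, hy⟩
    rwa [show x = y from funext fun i => (h i).unique (hy i)]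
  · exact fun hM => ⟨x, hM, h⟩

theorem sat_ofAtom (idx : (ℕ → ℕ → ℕ → Prop) → ℕ) {ρ : Fin 6 → ℕ}
    (hρ : ∀ v, IsLeast (nums M V (ofTm (.var v))) (ρ v)) (A : Atom) (w : Pt) :
    Sat (Acc M) V (ofAtom idx A) w ↔
      M ![idx A.rel, A.fst.eval ρ, A.snd.eval ρ, A.trd.eval ρ] := by
  refine sat_fact_iff M V (fun i => ?_) w
  fin_cases i
  · exact isLeast_ofNat M V _
  all_goals exact isLeast_eval M V hρ _

theorem sat_ofProgram {idx : (ℕ → ℕ → ℕ → Prop) → ℕ} {P : List Clause}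
    (hP : ∀ C ∈ P, C.Valid)
    (hM : ∀ C ∈ P, ∀ A ∈ C.concl :: C.prems, ∀ x y z, M ![idx A.rel, x, y, z] ↔ A.rel x y z)
    (w : Pt) : Sat (Acc M) V (ofProgram idx P) w := by
  rw [ofProgram, sat_conj]
  simp only [List.forall_mem_cons, List.forall_mem_map, sat_imp, sat_guard]
  refine ⟨⟨0, (isLeast_zero M V).1⟩, fun h => ?_, fun C hC => ?_⟩
  · exact ⟨_, (isLeast_succ M V ⟨Nat.sInf_mem h, fun _ => Nat.sInf_le⟩).1⟩
  · rw [ofClause, sat_imp, sat_conj]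
    intro h
    simp only [clausePrems, List.mem_append, List.mem_map, or_imp, forall_and,
      forall_exists_index, and_imp, forall_apply_eq_imp_iff₂, sat_guard] at h
    obtain ⟨hg, hp⟩ := h
    -- The guards make these sets nonempty, so the valuation induces an assignment of numbers under
    -- which the modal clause says the same as the Horn clause.
    have hρ : ∀ v, IsLeast (nums M V (ofTm (.var v))) (sInf (nums M V (ofTm (.var v)))) :=
      fun v => ⟨Nat.sInf_mem (hg v (List.mem_finRange v)), fun _ => Nat.sInf_le⟩
    rw [sat_ofAtom M V idx hρ, hM C hC _ (by simp)]
    refine hP C hC _ fun A hA => ?_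
    have := hp A hA
    rwa [sat_ofAtom M V idx hρ, hM C hC _ (by simp [hA])] at this

end FactFrame

/-! ### Computability of the reduction -/

namespace UForm

theorem primrec_iff_toNat {α : Type*} [Primcodable α] {f : α → UForm} :
    Primrec f ↔ Primrec fun a => toNat (f a) :=
  (Primrec.of_equiv_iff equivNat).symm

theorem primrec_toNat : Primrec toNat :=
  primrec_iff_toNat.1 Primrec.id

variable {α : Type*} [Primcodable α] {f g : α → UForm}

theorem primrec_neg (hf : Primrec f) : Primrec fun a => neg (f a) :=
  primrec_iff_toNat.2 (Primrec.nat_add.comp (Primrec.nat_mul.comp (.const 5)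
    (primrec_toNat.comp hf)) (.const 1))

theorem primrec_box (hf : Primrec f) : Primrec fun a => box (f a) :=
  primrec_iff_toNat.2 (Primrec.nat_add.comp (Primrec.nat_mul.comp (.const 5)
    (primrec_toNat.comp hf)) (.const 2))

theorem primrec_univ (hf : Primrec f) : Primrec fun a => univ (f a) :=
  primrec_iff_toNat.2 (Primrec.nat_add.comp (Primrec.nat_mul.comp (.const 5)
    (primrec_toNat.comp hf)) (.const 3))

theorem primrec_and (hf : Primrec f) (hg : Primrec g) : Primrec fun a => and (f a) (g a) :=
  primrec_iff_toNat.2 (Primrec.nat_add.comp (Primrec.nat_mul.comp (.const 5)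
    (Primrec₂.natPair.comp (primrec_toNat.comp hf) (primrec_toNat.comp hg))) (.const 4))

theorem primrec_dia (hf : Primrec f) : Primrec fun a => dia (f a) :=
  primrec_neg (primrec_box (primrec_neg hf))

theorem primrec_exist (hf : Primrec f) : Primrec fun a => exist (f a) :=
  primrec_neg (primrec_univ (primrec_neg hf))

theorem primrec_imp (hf : Primrec f) (hg : Primrec g) : Primrec fun a => imp (f a) (g a) :=
  primrec_neg (primrec_and hf (primrec_neg hg))

theorem primrec_slot (i : ℕ) (hf : Primrec f) : Primrec fun a => slot i (f a) := by
  have h := primrec_dia (primrec_and (.const chain) hf)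
  exact primrec_dia (primrec_and (.const _) (primrec_and h (primrec_neg (primrec_dia h))))

theorem primrec_numeral : Primrec fun n => ofTm (Horn.Tm.ofNat n) := by
  have h : Primrec₂ fun (_ : ℕ) (φ : UForm) => dia (and chain φ) :=
    primrec_dia (primrec_and (.const chain) Primrec.snd)
  refine (Primrec.nat_rec₁ top h).of_eq fun n => ?_
  induction n with
  | zero => rfl
  | succ n ih => simp only [ih, ofTm, Horn.Tm.ofNat]

theorem primrec_fact {x : Fin 4 → α → ℕ} (hx : ∀ i, Primrec (x i)) :
    Primrec fun a => fact fun i => Horn.Tm.ofNat (x i a) := by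
  have h : ∀ j i, Primrec fun a => slot j (ofTm (Horn.Tm.ofNat (x i a))) :=
    fun j i => primrec_slot j (primrec_numeral.comp (hx i))
  exact primrec_exist (primrec_and (primrec_and (h _ _) (h _ _)) (primrec_and (h _ _) (h _ _)))

end UForm

/-! ### The reduction from the halting problem -/

open UForm Horn

/-- Unifiability expresses membership in the graph of a Horn definable function. -/
theorem exists_formula_unifiableIn_iff {L : Set UForm} (hL : IsNormalLogicU L)
    (hK4u : L ⊆ logicK4u) {f : ℕ →. ℕ} (hf : Definable f) :
    ∃ (η : UForm) (q : ℕ), ∀ x y, UnifiableIn L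
      (imp η (fact fun i => Tm.ofNat ((![q, x, y, 0] : Fin 4 → ℕ) i))) ↔ y ∈ f x := by
  classical
  obtain ⟨P, hP, hder⟩ := hf
  let rels : List (ℕ → ℕ → ℕ → Prop) :=
    graph f :: P.flatMap fun C => (C.concl :: C.prems).map Atom.rel
  let idx : (ℕ → ℕ → ℕ → Prop) → ℕ := fun r => rels.idxOf r
  -- The first coordinate selects a relation by its position in `rels`; positions beyond the list
  -- carry no facts.
  let M : (Fin 4 → ℕ) → Prop := fun x => rels.getD (x 0) (fun _ _ _ => False) (x 1) (x 2) (x 3)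
  have hM : ∀ r ∈ rels, ∀ x y z, M ![idx r, x, y, z] ↔ r x y z := by
    intro r hr x y z
    have h : rels.getD (idx r) (fun _ _ _ => False) = r := by
      rw [List.getD_eq_getElem _ _ (List.idxOf_lt_length_of_mem hr)]
      exact List.getElem_idxOf _
    exact iff_of_eq (congrFun (congrFun (congrFun h x) y) z)
  refine ⟨ofProgram idx P, idx (graph f), fun x y => ⟨?_, fun h => ?_⟩⟩
  · rintro ⟨σ, hσ⟩
    -- The valuation is immaterial: the unifier replaces it by another one, and the program holds
    -- under all of them.
    have h := logicK4u_subset_frameLogic _ (FactFrame.acc_trans M) (hK4u hσ) (fun _ _ => False)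
      (FactFrame.Pt.num 0)
    rw [sat_subst, sat_imp] at h
    have hfact := h (FactFrame.sat_ofProgram M _ hP (fun C hC A hA => hM _
      (List.mem_cons_of_mem _ (List.mem_flatMap.2 ⟨C, hC, List.mem_map_of_mem hA⟩))) _)
    rw [FactFrame.sat_fact_iff M _ (fun i => FactFrame.isLeast_ofNat M _ _)] at hfact
    exact (hM _ List.mem_cons_self _ _ _).1 hfact
  · exact unifiableIn_of_derives hL (hder x y h)

/-- The unification problem for every normal modal logic with the universal modality between
`K_u` and `K4_u` is undecidable. -/
theorem theorem1 (L : Set UForm) (hL : IsNormalLogicU L) (hKu : logicKu ⊆ L)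
    (hK4u : L ⊆ logicK4u) : ¬ ComputablePred (fun φ : UForm => UnifiableIn L φ) := by
  intro hdec
  -- The value is `0` when the `n`-th code halts on input `0`, and undefined otherwise, so halting
  -- becomes membership of `0`.
  let f : ℕ →. ℕ := fun n =>
    (Nat.Partrec.Code.eval (Denumerable.ofNat Nat.Partrec.Code n) 0).map fun _ => 0
  have hf : Nat.Partrec f := Partrec.nat_iff.1 <| Partrec.map
    (Nat.Partrec.Code.eval_part.comp (Computable.ofNat _) (Computable.const 0))
    (Computable.const 0).to₂
  obtain ⟨η, q, h⟩ := exists_formula_unifiableIn_iff hL hK4u (definable_of_partrec hf)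
  let F : Nat.Partrec.Code → UForm := fun c =>
    imp η (fact fun i => Tm.ofNat ((![q, Encodable.encode c, 0, 0] : Fin 4 → ℕ) i))
  have hF : Computable F := by
    -- The program formula is fixed; only the numeral of the code varies.
    refine (primrec_imp (.const η) (primrec_fact
      (x := fun i c => (![q, Encodable.encode c, 0, 0] : Fin 4 → ℕ) i) fun i => ?_)).to_comp
    fin_cases i
    exacts [.const q, .encode, .const 0, .const 0]
  refine ComputablePred.halting_problem 0
    (ComputablePred.computable_of_manyOneReducible ⟨F, hF, fun c => ?_⟩ hdec)
  rw [h]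
  simp only [f, Denumerable.ofNat_encode, Part.mem_map_iff, and_true, Part.dom_iff_mem]
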